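/- Let $SO(3)$ and $O(3)$ be the special orthogonal and the orthogonal group of real $3\times 3$ matrices, with unit $I$, and let $\mathbb{T}=\{z\in\mathbb{C}:|z|=1\}$. Let $N$ be a positive constant multiple of the Frobenius norm on the complex $3\times 3$ matrices, and let $f\colon\mathbb{T}\to\mathbb{C}$ be a bounded function such that (f1) $f(z)=0$ if and only if $z=1$; (f2) $f$ is conformal in a neighbourhood of $1$, i.e. there are an open set $U\subseteq\mathbb{C}$ with $1\in U$ and a holomorphic function $F\colon U\to\mathbb{C}$ with nowhere vanishing derivative such that $f=F$ on $U\cap\mathbb{T}$; (f3) $f$ is continuous on $\mathbb{T}\setminus\{-1\}$; (f4) $f(-1)=\lim_{t\uparrow\pi}f(e^{\mathrm{i}t})$ (in particular, the limit exists). For $A,B\in SO(3)$ put $d_{N,f}(A,B)=N(f(A^{-1}B))$, where, for $C\in SO(3)$, the complex matrix $f(C)$ is given by the Borel functional calculus, that is, $f(C)=\sum_{z}f(z)P_z$ with $z$ running over the eigenvalues of $C$ and $P_z$ the orthogonal projection of $\mathbb{C}^3$ onto the eigenspace of $z$. Let $\phi\colon SO(3)\to SO(3)$ be any map. Then $d_{N,f}(\phi(A),\phi(B))=d_{N,f}(A,B)$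 holds for all $A,B\in SO(3)$ if and only if there exists $Q\in O(3)$ such that one of the following holds: (a) $\phi(A)=\phi(I)QAQ^{-1}$ for all $A\in SO(3)$; (b) $\phi(A)=\phi(I)QA^{-1}Q^{-1}$ for all $A\in SO(3)$. -/

import Mathlib

open Filter Topology

/-- The special orthogonal group `SO(n)`. -/
abbrev SO (n : ℕ) : Type := Matrix.specialOrthogonalGroup (Fin n) ℝ

/-- The orthogonal group `O(n)`. -/
abbrev OrthoGroup (n : ℕ) : Type := Matrix.orthogonalGroup (Fin n) ℝ

/-- `f` is conformal in a neighbourhood of `1`: near `1` it is the restriction to the unit circle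
of a holomorphic function, defined on an open subset of the plane, whose derivative has no zero. -/
def ConformalNearOne (f : Circle → ℂ) : Prop :=
  ∃ (U : Set ℂ) (F : ℂ → ℂ), IsOpen U ∧ (1 : ℂ) ∈ U ∧ DifferentiableOn ℂ F U ∧
    (∀ z ∈ U, deriv F z ≠ 0) ∧ ∀ z : Circle, (z : ℂ) ∈ U → f z = F z

/-- The bounded functions `f` on the unit circle from which the distance measures are built. -/
structure Admissible (f : Circle → ℂ) : Prop where
  bounded : ∃ C : ℝ, ∀ z, ‖f z‖ ≤ C
  eq_zero_iff : ∀ z, f z = 0 ↔ z = 1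
  conformal : ConformalNearOne f
  continuousOn : ContinuousOn f {-1}ᶜ
  tendsto_left : Tendsto (fun t : ℝ => f (Circle.exp t)) (𝓝[<] Real.pi) (𝓝 (f (-1)))

open Classical in
/-- The extension by zero of a function on the unit circle to the complex plane. -/
noncomputable def extendCircle (f : Circle → ℂ) (z : ℂ) : ℂ :=
  if h : z ∈ Submonoid.unitSphere ℂ then f ⟨z, h⟩ else 0

section

open scoped Matrix.Norms.L2Operator

/-- `f(A)` for a real orthogonal matrix `A`, by the functional calculus of `A` as a normal complex
matrix. The spectrum of `A` is a finite subset of the unit circle, so that every function is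
continuous on it, and this is the Borel functional calculus
`f(A) = ∑ f(z) P_z`, where `P_z` is the orthogonal projection onto the eigenspace of `z`. -/
noncomputable def applySO {n : ℕ} (f : Circle → ℂ) (A : SO n) : Matrix (Fin n) (Fin n) ℂ :=
  cfc (extendCircle f) ((A : Matrix (Fin n) (Fin n) ℝ).map Complex.ofReal)

end

/-- The Frobenius norm of a complex matrix. -/
noncomputable def frobeniusNorm {n : ℕ} (M : Matrix (Fin n) (Fin n) ℂ) : ℝ :=
  (Matrix.frobeniusNormedAddCommGroup : NormedAddCommGroup (Matrix (Fin n) (Fin n) ℂ)).norm M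

/-- `N` is a (positive) constant multiple of the Frobenius norm. -/
def IsFrobeniusMultiple {n : ℕ} (N : Matrix (Fin n) (Fin n) ℂ → ℝ) : Prop :=
  ∃ c : ℝ, 0 < c ∧ ∀ M, N M = c * frobeniusNorm M

/-- The generalized distance measure `d_{N,f}(A,B) = N(f(A⁻¹B))` on `SO(n)`. -/
noncomputable def genDist {n : ℕ} (N : Matrix (Fin n) (Fin n) ℂ → ℝ) (f : Circle → ℂ)
    (A B : SO n) : ℝ :=
  N (applySO f (A⁻¹ * B))

/-!
Write a rotation as `C = rot p` with a unit quaternion `p`, unique up to sign. Then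
`tr (rot p)ᵀ (rot q) = 4 ⟪p, q⟫² - 1`, so that the angle `θ` of `(rot p)⁻¹ (rot q)` satisfies
`cos θ = 2 ⟪p, q⟫² - 1`. The eigenvalues of `C` are `1` and `exp (± i θ)`, and `f 1 = 0`, hence the
squared Frobenius norm of `f(C)` is `angleProfile f θ = |f (exp (i θ))|² + |f (exp (- i θ))|²`
(`frobeniusNorm_applySO`). In particular the distance measure depends only on
`tr (A⁻¹ B)`, which shows that the maps (a) and (b) preserve it.

For the converse, the profile need not be injective on `[0, π]`, but it determines small angles
(`Admissible.exists_eq_of_angleProfile_eq`): it is strictly increasing near `0` because `f` is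
conformal there, and it is bounded below on `[δ, π]` because of the continuity of `f` and its left
continuity at `-1`. Hence a map `φ` preserving the distance measure, composed with the left
multiplication by `φ(I)⁻¹`, lifts to a map `Φ` of the unit sphere of the quaternions that preserves
`|⟪p, q⟫|` when this number is close to `1`. No continuity or bijectivity of `φ` is needed.

By a local form of Wigner's theorem (`PreservesAbsInner.exists_linearIsometryEquiv`) such a map is
a linear isometry up to signs. Indeed, near one point the signs can be chosen so that inner
products are preserved, which makes `Φ` linear there; dividing by this linear isometry, `Φ` becomes
the identity up to sign near one point, and this property spreads over the connected sphere.

The isometry can be taken to fix the quaternion `1`, so it is given by some `Q ∈ O(3)` on the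
imaginary quaternions. Since `Q rot(w + v) Qᵀ = rot(det Q • w + Q v)` (`mul_rot_mul_transpose`) and
`rot(-w + v) = (rot(w + v))ᵀ`, the two signs of `det Q` give the cases (a) and (b).
-/

/-! ### Maps of a sphere that preserve inner products up to sign, at small distance -/

section Sphere

variable {E : Type*} [NormedAddCommGroup E] [InnerProductSpace ℝ E]

theorem inner_eq_one_sub_norm_sub_sq_div_two {x y : E} (hx : ‖x‖ = 1) (hy : ‖y‖ = 1) :
    inner ℝ x y = 1 - ‖x - y‖ ^ 2 / 2 := by
  rw [norm_sub_sq_real, hx, hy]; ring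

theorem half_lt_inner_of_norm_sub_lt_one {x y : E} (hx : ‖x‖ = 1) (hy : ‖y‖ = 1)
    (h : ‖x - y‖ < 1) : 1 / 2 < inner ℝ x y := by
  rw [inner_eq_one_sub_norm_sub_sq_div_two hx hy]
  nlinarith [norm_nonneg (x - y)]

theorem eq_of_forall_inner_eq_of_span_eq_top {S : Set E} (hS : Submodule.span ℝ S = ⊤) {x y : E}
    (h : ∀ s ∈ S, inner ℝ s x = inner ℝ s y) : x = y := by
  refine ext_inner_left ℝ fun v => ?_
  have hv : v ∈ Submodule.span ℝ S := hS ▸ Submodule.mem_top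
  induction hv using Submodule.span_induction with
  | mem s hs => exact h s hs
  | zero => simp
  | add a b _ _ ha hb => simp [inner_add_left, ha, hb]
  | smul c a _ ha => simp [inner_smul_left, ha]

/-- The unit vectors close to a given unit vector span the space: the cone over them is a
neighbourhood of that vector. -/
theorem span_sphere_inter_ball_eq_top {p : E} (hp : ‖p‖ = 1) {ε : ℝ} (hε : 0 < ε) :
    Submodule.span ℝ {x : E | ‖x‖ = 1 ∧ ‖x - p‖ < ε} = ⊤ := by
  refine Submodule.eq_top_of_nonempty_interior' _ ⟨p, ?_⟩
  rw [mem_interior_iff_mem_nhds]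
  have hp0 : p ≠ 0 := by rintro rfl; simp at hp
  have hc : ContinuousAt (fun x : E => ‖x‖⁻¹ • x) p :=
    (continuousAt_id.norm.inv₀ (by simp [hp0])).smul continuousAt_id
  have h1 : ∀ᶠ x in 𝓝 p, ‖x‖⁻¹ • x ∈ Metric.ball p ε := by
    refine hc.eventually_mem (Metric.isOpen_ball.mem_nhds ?_)
    simp [hp, hε]
  filter_upwards [h1, continuousAt_id.eventually_ne hp0] with x hx hx0
  have hx0' : ‖x‖ ≠ 0 := norm_ne_zero_iff.2 hx0
  have : x = ‖x‖ • (‖x‖⁻¹ • x) := by rw [smul_smul, mul_inv_cancel₀ hx0', one_smul]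
  rw [this]
  refine Submodule.smul_mem _ _ (Submodule.subset_span ⟨?_, ?_⟩)
  · rw [norm_smul, norm_inv, norm_norm, inv_mul_cancel₀ hx0']
  · simpa [dist_eq_norm] using hx

/-- A map preserving the inner products of the vectors of a spanning set agrees on that set with
a linear isometry. -/
theorem exists_linearIsometryEquiv_of_inner_eq [FiniteDimensional ℝ E] {S : Set E}
    (hS : Submodule.span ℝ S = ⊤) {g : E → E}
    (hg : ∀ x ∈ S, ∀ y ∈ S, inner ℝ (g x) (g y) = inner ℝ x y) :
    ∃ T : E ≃ₗᵢ[ℝ] E, ∀ x ∈ S, T x = g x := by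
  let b := Module.Basis.ofSpan hS.ge
  have hbS : ∀ i, b i ∈ S := fun i => Module.Basis.ofSpan_subset hS.ge ⟨i, rfl⟩
  let L : E →ₗ[ℝ] E := b.constr ℝ (fun i => g (b i))
  have hLb : ∀ i, L (b i) = g (b i) := fun i => b.constr_basis ℝ _ i
  have hbi : (innerₗ E).compl₁₂ L L = innerₗ E := by
    refine b.ext fun i => b.ext fun j => ?_
    simp [hLb, hg _ (hbS i) _ (hbS j)]
  have hin : ∀ x y, inner ℝ (L x) (L y) = inner ℝ x y := fun x y => by
    simpa using LinearMap.congr_fun (LinearMap.congr_fun hbi x) y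
  let T := (L.isometryOfInner hin).toLinearIsometryEquiv rfl
  have hT : ∀ x, T x = L x := fun x => rfl
  refine ⟨T, fun x hx => ?_⟩
  refine T.symm.injective (eq_of_forall_inner_eq_of_span_eq_top b.span_eq ?_)
  rintro _ ⟨i, rfl⟩
  rw [← T.inner_map_map, ← T.inner_map_map (b i) (T.symm (g x)), T.apply_symm_apply,
    T.apply_symm_apply, hT x, hT (b i), hin, hLb, hg _ (hbS i) _ hx]

/-- `Φ` maps unit vectors to unit vectors, and preserves the absolute value of the inner product
of two unit vectors whenever that absolute value is at least `κ`. -/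
structure PreservesAbsInner (κ : ℝ) (Φ : E → E) : Prop where
  norm_eq_one : ∀ p, ‖p‖ = 1 → ‖Φ p‖ = 1
  abs_inner : ∀ p q, ‖p‖ = 1 → ‖q‖ = 1 → κ ≤ |inner ℝ p q| →
    |inner ℝ (Φ p) (Φ q)| = |inner ℝ p q|

theorem PreservesAbsInner.abs_inner_of_norm_sub_lt {κ : ℝ} {Φ : E → E}
    (h : PreservesAbsInner κ Φ) {p q : E} (hp : ‖p‖ = 1) (hq : ‖q‖ = 1) (h1 : ‖p - q‖ < 1)
    (hκ : ‖p - q‖ < 1 - κ) : |inner ℝ (Φ p) (Φ q)| = inner ℝ p q := by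
  have h2 := half_lt_inner_of_norm_sub_lt_one hp hq h1
  rw [h.abs_inner p q hp hq, abs_of_pos (by linarith)]
  rw [abs_of_pos (by linarith), inner_eq_one_sub_norm_sub_sq_div_two hp hq]
  nlinarith [norm_nonneg (p - q)]

/-- One of the vectors `x`, `-x` has the inner product `|⟪x, y⟫|` with `y`. -/
theorem exists_sign_inner_eq {x y : E} {a : ℝ} (h : |inner ℝ x y| = a) :
    ∃ z, (z = x ∨ z = -x) ∧ inner ℝ z y = a := by
  rcases abs_choice (inner ℝ x y) with h' | h'
  · exact ⟨x, .inl rfl, by rw [← h, h']⟩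
  · exact ⟨-x, .inr rfl, by rw [inner_neg_left, ← h, h']⟩

/-- The sign of `Φ` can be chosen near `p₀` in such a way that inner products are preserved there,
so that `Φ` is linear up to sign near `p₀`. -/
theorem PreservesAbsInner.exists_local [FiniteDimensional ℝ E] {κ : ℝ} (hκ : κ < 1) {Φ : E → E}
    (h : PreservesAbsInner κ Φ) {p₀ : E} (hp₀ : ‖p₀‖ = 1) :
    ∃ T : E ≃ₗᵢ[ℝ] E, ∃ ε > 0, ∀ p, ‖p‖ = 1 → ‖p - p₀‖ < ε → Φ p = T p ∨ Φ p = -T p := by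
  obtain ⟨η, hη0, hη1, hηκ⟩ : ∃ η : ℝ, 0 < η ∧ η ≤ 1 ∧ η ≤ 1 - κ :=
    ⟨min 1 (1 - κ), lt_min one_pos (by linarith), min_le_left _ _, min_le_right _ _⟩
  have hex : ∀ p : E, ∃ z, ‖p‖ = 1 → ‖p - p₀‖ < η / 2 →
      (z = Φ p ∨ z = -Φ p) ∧ inner ℝ z (Φ p₀) = inner ℝ p p₀ := by
    intro p
    by_cases hp : ‖p‖ = 1 ∧ ‖p - p₀‖ < η / 2
    · obtain ⟨z, hz⟩ := exists_sign_inner_eq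
        (h.abs_inner_of_norm_sub_lt hp.1 hp₀ (by linarith [hp.2]) (by linarith [hp.2]))
      exact ⟨z, fun _ _ => hz⟩
    · exact ⟨0, fun h1 h2 => absurd ⟨h1, h2⟩ hp⟩
  choose g hg using hex
  have hgn : ∀ p, ‖p‖ = 1 → ‖p - p₀‖ < η / 2 → ‖g p‖ = 1 := fun p hp hpp => by
    rcases (hg p hp hpp).1 with h' | h' <;> simp [h', h.norm_eq_one p hp]
  have hgd : ∀ p, ‖p‖ = 1 → ‖p - p₀‖ < η / 2 → ‖g p - Φ p₀‖ < η / 2 := fun p hp hpp => by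
    have h1 := inner_eq_one_sub_norm_sub_sq_div_two (hgn p hp hpp) (h.norm_eq_one p₀ hp₀)
    have h2 := inner_eq_one_sub_norm_sub_sq_div_two hp hp₀
    rw [(hg p hp hpp).2, h2] at h1
    refine lt_of_pow_lt_pow_left₀ 2 (by positivity) ?_
    have := pow_lt_pow_left₀ hpp (norm_nonneg _) two_ne_zero
    linarith
  obtain ⟨T, hT⟩ := exists_linearIsometryEquiv_of_inner_eq
    (span_sphere_inter_ball_eq_top hp₀ (half_pos hη0)) (g := g) (by
    rintro p ⟨hp, hpp⟩ q ⟨hq, hqp⟩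
    have hpq : ‖p - q‖ < η := by
      have := norm_sub_le_norm_sub_add_norm_sub p p₀ q
      rw [norm_sub_rev p₀ q] at this; linarith
    have hgpq : ‖g p - g q‖ < 1 := by
      have := norm_sub_le_norm_sub_add_norm_sub (g p) (Φ p₀) (g q)
      rw [norm_sub_rev (Φ p₀) (g q)] at this
      linarith [hgd p hp hpp, hgd q hq hqp]
    have h1 := half_lt_inner_of_norm_sub_lt_one (hgn p hp hpp) (hgn q hq hqp) hgpq
    rw [← h.abs_inner_of_norm_sub_lt hp hq (by linarith) (by linarith),
      ← abs_of_pos (show 0 < inner ℝ (g p) (g q) by linarith)]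
    rcases (hg p hp hpp).1 with h2 | h2 <;> rcases (hg q hq hqp).1 with h3 | h3 <;>
      simp [h2, h3, inner_neg_left, inner_neg_right, abs_neg])
  refine ⟨T, η / 2, half_pos hη0, fun p hp hpp => ?_⟩
  rw [hT p ⟨hp, hpp⟩]
  rcases (hg p hp hpp).1 with h' | h' <;> simp [h']

/-- If `Φ` is the identity up to sign near one unit vector, it is so on the whole sphere: the inner
products with the vectors close to a given one determine all vectors at a distance that is bounded
below uniformly, and the sphere is connected. -/
theorem PreservesAbsInner.eq_or_eq_neg {κ : ℝ} (hκ : κ < 1) {Φ : E → E}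
    (h : PreservesAbsInner κ Φ) (hE : 1 < Module.rank ℝ E) {p₀ : E} (hp₀ : ‖p₀‖ = 1) {ε : ℝ}
    (hε : 0 < ε) (hΦ : ∀ p, ‖p‖ = 1 → ‖p - p₀‖ < ε → Φ p = p ∨ Φ p = -p) {p : E} (hp : ‖p‖ = 1) :
    Φ p = p ∨ Φ p = -p := by
  obtain ⟨η, hη0, hη1, hηκ⟩ : ∃ η : ℝ, 0 < η ∧ η ≤ 1 ∧ η ≤ 1 - κ :=
    ⟨min 1 (1 - κ), lt_min one_pos (by linarith), min_le_left _ _, min_le_right _ _⟩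
  have : PreconnectedSpace (Metric.sphere (0 : E) 1) :=
    Subtype.preconnectedSpace (isPreconnected_sphere hE 0 1)
  let U : Set (Metric.sphere (0 : E) 1) :=
    {x | ∀ᶠ y : Metric.sphere (0 : E) 1 in 𝓝 x, Φ y = y ∨ Φ y = -y}
  have hnorm : ∀ x : Metric.sphere (0 : E) 1, ‖(x : E)‖ = 1 := fun x => by simp
  have hopen : IsOpen U := isOpen_setOfPred_eventually_nhds
  have hclosed : IsClosed U := by
    refine isClosed_of_closure_subset fun x hx => ?_
    obtain ⟨y, hyU, hxy⟩ := Metric.mem_closure_iff.1 hx (η / 4) (by positivity)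
    obtain ⟨δ, hδ, hyδ⟩ := Metric.eventually_nhds_iff.1 hyU
    refine Metric.eventually_nhds_iff.2 ⟨η / 4, by positivity, fun q hq => ?_⟩
    have hqy : ‖(q : E) - y‖ < η / 2 := by
      have := dist_triangle q x y
      rw [← dist_eq_norm, ← Subtype.dist_eq]; linarith
    have hy := hyU.self_of_nhds
    obtain ⟨m, hm, hmy⟩ : ∃ m, (m = Φ q ∨ m = -Φ q) ∧ inner ℝ m (y : E) = inner ℝ (q : E) y := by
      refine exists_sign_inner_eq ?_
      rw [← h.abs_inner_of_norm_sub_lt (hnorm q) (hnorm y) (by linarith) (by linarith)]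
      rcases hy with h' | h' <;> simp [h', inner_neg_right]
    have hmn : ‖m‖ = 1 := by
      rcases hm with h' | h' <;> simp [h', h.norm_eq_one _ (hnorm q)]
    have hmy' : ‖m - y‖ < η / 2 := by
      have h1 := inner_eq_one_sub_norm_sub_sq_div_two hmn (hnorm y)
      have h2 := inner_eq_one_sub_norm_sub_sq_div_two (hnorm q) (hnorm y)
      rw [hmy, h2] at h1
      refine lt_of_pow_lt_pow_left₀ 2 (by positivity) ?_
      have := pow_lt_pow_left₀ hqy (norm_nonneg _) two_ne_zero
      linarith
    have hmq : m = q := by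
      refine eq_of_forall_inner_eq_of_span_eq_top (span_sphere_inter_ball_eq_top (hnorm y)
        (lt_min hδ (half_pos hη0))) ?_
      rintro s ⟨hs, hsy⟩
      have hsδ := hyδ (y := ⟨s, by simpa using hs⟩)
        (by rw [Subtype.dist_eq, dist_eq_norm]; exact hsy.trans_le (min_le_left _ _))
      have hsη := hsy.trans_le (min_le_right _ _)
      have h1 : ‖s - q‖ < η := by
        have := norm_sub_le_norm_sub_add_norm_sub s y q
        rw [norm_sub_rev (y : E) q] at this; linarith
      have h2 : ‖s - m‖ < 1 := by
        have := norm_sub_le_norm_sub_add_norm_sub s y m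
        rw [norm_sub_rev (y : E) m] at this; linarith
      have h3 := half_lt_inner_of_norm_sub_lt_one hs hmn h2
      rw [← h.abs_inner_of_norm_sub_lt hs (hnorm q) (by linarith) (by linarith),
        ← abs_of_pos (show 0 < inner ℝ s m by linarith)]
      rcases hm with h4 | h4 <;> rcases hsδ with h5 | h5 <;> simp only at h5 <;>
        simp [h4, h5, inner_neg_left, inner_neg_right, abs_neg]
    rcases hm with h' | h'
    · exact .inl (h' ▸ hmq)
    · exact .inr (by rw [← neg_eq_iff_eq_neg, ← h', hmq])
  have huniv : U = Set.univ := IsClopen.eq_univ ⟨hclosed, hopen⟩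
    ⟨⟨p₀, by simpa using hp₀⟩, Metric.eventually_nhds_iff.2 ⟨ε, hε, fun q hq =>
      hΦ q (hnorm q) (by rwa [Subtype.dist_eq, dist_eq_norm] at hq)⟩⟩
  have hpU : ∀ᶠ y : Metric.sphere (0 : E) 1 in 𝓝 ⟨p, by simpa using hp⟩, Φ y = y ∨ Φ y = -y :=
    huniv.ge (Set.mem_univ _)
  exact hpU.self_of_nhds

/-- A local form of Wigner's theorem: up to signs, a map of the unit sphere preserving the large
values of `|⟪p, q⟫|` is a linear isometry. -/
theorem PreservesAbsInner.exists_linearIsometryEquiv [FiniteDimensional ℝ E] {κ : ℝ} (hκ : κ < 1)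
    {Φ : E → E} (h : PreservesAbsInner κ Φ) (hE : 1 < Module.rank ℝ E) :
    ∃ T : E ≃ₗᵢ[ℝ] E, ∀ p, ‖p‖ = 1 → Φ p = T p ∨ Φ p = -T p := by
  have : Nontrivial E := by
    rw [← rank_pos_iff_nontrivial (R := ℝ)]; exact zero_lt_one.trans hE
  obtain ⟨p₀, hp₀⟩ := exists_norm_eq E zero_le_one
  obtain ⟨T, ε, hε, hT⟩ := h.exists_local hκ hp₀
  have h' : PreservesAbsInner κ (fun p => T.symm (Φ p)) :=
    ⟨fun p hp => by simp [h.norm_eq_one p hp], fun p q hp hq hpq => by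
      simp [h.abs_inner p q hp hq hpq]⟩
  refine ⟨T, fun p hp => ?_⟩
  refine (h'.eq_or_eq_neg hκ hE hp₀ hε (fun q hq hqp => ?_) hp).imp (fun h1 => ?_) (fun h1 => ?_)
  · exact (hT q hq hqp).imp (fun h1 => by simp [h1]) (fun h1 => by simp [h1])
  · rw [← T.apply_symm_apply (Φ p), h1]
  · rw [← T.apply_symm_apply (Φ p), h1, map_neg]

end Sphere

/-! ### Rotations and unit quaternions -/

section Rotation

open Matrix

/-- The matrix `(w² - ‖v‖²) I + 2 w [v]ₓ + 2 v vᵀ` of the quaternion `p = w + v`, whose real part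
`w` is the coordinate `0` of `p`. It is the matrix of `x ↦ p x p̄` on the imaginary quaternions,
hence a rotation if `p` is a unit vector. -/
def rot (p : EuclideanSpace ℝ (Fin 4)) : Matrix (Fin 3) (Fin 3) ℝ :=
  !![p 0 ^ 2 + p 1 ^ 2 - p 2 ^ 2 - p 3 ^ 2, 2 * (p 1 * p 2 - p 0 * p 3),
      2 * (p 1 * p 3 + p 0 * p 2);
    2 * (p 1 * p 2 + p 0 * p 3), p 0 ^ 2 - p 1 ^ 2 + p 2 ^ 2 - p 3 ^ 2,
      2 * (p 2 * p 3 - p 0 * p 1);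
    2 * (p 1 * p 3 - p 0 * p 2), 2 * (p 2 * p 3 + p 0 * p 1),
      p 0 ^ 2 - p 1 ^ 2 - p 2 ^ 2 + p 3 ^ 2]

theorem rot_neg (p : EuclideanSpace ℝ (Fin 4)) : rot (-p) = rot p := by
  simp [rot]

theorem inner_fin_four (p q : EuclideanSpace ℝ (Fin 4)) :
    inner ℝ p q = p 0 * q 0 + p 1 * q 1 + p 2 * q 2 + p 3 * q 3 := by
  simp [PiLp.inner_apply, Fin.sum_univ_four, mul_comm]

/-- The rotation angle of `(rot p)⁻¹ * rot q` is twice the angle between the lines of `p`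
and `q`. -/
theorem trace_rot_transpose_mul_rot {p q : EuclideanSpace ℝ (Fin 4)} (hp : ‖p‖ = 1)
    (hq : ‖q‖ = 1) : ((rot p)ᵀ * rot q).trace = 4 * inner ℝ p q ^ 2 - 1 := by
  have h1 : p 0 * p 0 + p 1 * p 1 + p 2 * p 2 + p 3 * p 3 = 1 := by
    rw [← inner_fin_four, real_inner_self_eq_norm_sq, hp, one_pow]
  have h2 : q 0 * q 0 + q 1 * q 1 + q 2 * q 2 + q 3 * q 3 = 1 := by
    rw [← inner_fin_four, real_inner_self_eq_norm_sq, hq, one_pow]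
  rw [inner_fin_four]
  simp only [Matrix.trace_fin_three, Matrix.mul_apply, Matrix.transpose_apply, Fin.sum_univ_three]
  simp [rot]
  linear_combination (-(q 0 * q 0 + q 1 * q 1 + q 2 * q 2 + q 3 * q 3)) * h1 - h2

theorem adjugate_eq_det_smul_transpose {Q : Matrix (Fin 3) (Fin 3) ℝ} (hQ : Q * Qᵀ = 1) :
    Q.adjugate = Q.det • Qᵀ := by
  calc Q.adjugate = Q.adjugate * (Q * Qᵀ) := by rw [hQ, mul_one]
    _ = Q.det • Qᵀ := by rw [← mul_assoc, adjugate_mul, smul_mul, one_mul]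

/-- The symmetric matrix that is `4 p pᵀ` when `A = rot p`. -/
def quatGram (A : Matrix (Fin 3) (Fin 3) ℝ) : Matrix (Fin 4) (Fin 4) ℝ :=
  !![1 + A 0 0 + A 1 1 + A 2 2, A 2 1 - A 1 2, A 0 2 - A 2 0, A 1 0 - A 0 1;
    A 2 1 - A 1 2, 1 + A 0 0 - A 1 1 - A 2 2, A 0 1 + A 1 0, A 0 2 + A 2 0;
    A 0 2 - A 2 0, A 0 1 + A 1 0, 1 - A 0 0 + A 1 1 - A 2 2, A 1 2 + A 2 1;
    A 1 0 - A 0 1, A 0 2 + A 2 0, A 1 2 + A 2 1, 1 - A 0 0 - A 1 1 + A 2 2]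

/-- The `2 × 2` minors of `quatGram A` vanish: they are combinations with constant coefficients of
the equations `A Aᵀ = 1`, `Aᵀ A = 1` and `A.adjugate = Aᵀ`. -/
theorem quatGram_mul_eq {A : Matrix (Fin 3) (Fin 3) ℝ} (hA : A * Aᵀ = 1) (hdet : A.det = 1)
    (i j k : Fin 4) :
    quatGram A i j * quatGram A k j = quatGram A i k * quatGram A j j := by
  have hA' : Aᵀ * A = 1 := mul_eq_one_comm.1 hA
  have hadj : A.adjugate = Aᵀ := by rw [adjugate_eq_det_smul_transpose hA, hdet, one_smul]
  rw [adjugate_fin_three] at hadj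
  have r : ∀ i j, _ := fun i j => congrFun (congrFun hA i) j
  have c : ∀ i j, _ := fun i j => congrFun (congrFun hA' i) j
  have a : ∀ i j, _ := fun i j => congrFun (congrFun hadj i) j
  simp only [Matrix.mul_apply, Fin.sum_univ_three, Matrix.transpose_apply] at r c
  have r00 := r 0 0
  have r01 := r 0 1
  have r02 := r 0 2
  have r11 := r 1 1
  have r12 := r 1 2
  have r22 := r 2 2
  have c00 := c 0 0
  have c01 := c 0 1
  have c02 := c 0 2
  have c11 := c 1 1
  have c12 := c 1 2
  have c22 := c 2 2
  have a00 := a 0 0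
  have a01 := a 0 1
  have a02 := a 0 2
  have a10 := a 1 0
  have a11 := a 1 1
  have a12 := a 1 2
  have a20 := a 2 0
  have a21 := a 2 1
  have a22 := a 2 2
  clear r c a hA hA' hadj hdet
  simp at r00 r01 r02 r11 r12 r22 c00 c01 c02 c11 c12 c22 a00 a01 a02 a10 a11 a12 a20 a21 a22
  fin_cases i <;> fin_cases j <;> fin_cases k <;> simp [quatGram] <;> linarith

/-- Every rotation is given by a unit quaternion: a column of `quatGram A` with positive diagonal
entry is a multiple of it. -/
theorem exists_rot_eq {A : Matrix (Fin 3) (Fin 3) ℝ} (hA : A * Aᵀ = 1) (hdet : A.det = 1) :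
    ∃ p : EuclideanSpace ℝ (Fin 4), ‖p‖ = 1 ∧ rot p = A := by
  have htr : quatGram A 0 0 + quatGram A 1 1 + quatGram A 2 2 + quatGram A 3 3 = 4 := by
    simp [quatGram]; ring
  obtain ⟨j, hj⟩ : ∃ j, 0 < quatGram A j j := by
    by_contra! h
    linarith [h 0, h 1, h 2, h 3]
  -- If `quatGram A = 4 p pᵀ`, then `p` is this multiple of the column `j`.
  let p : EuclideanSpace ℝ (Fin 4) :=
    WithLp.toLp 2 fun i => quatGram A i j / (2 * √(quatGram A j j))
  have hs : √(quatGram A j j) ≠ 0 := (Real.sqrt_pos.2 hj).ne'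
  have hp : ∀ i k, p i * p k = quatGram A i k / 4 := fun i k => by
    simp only [p]
    rw [div_mul_div_comm, quatGram_mul_eq hA hdet, mul_mul_mul_comm, Real.mul_self_sqrt hj.le]
    field_simp
    norm_num
  refine ⟨p, ?_, ?_⟩
  · have : ‖p‖ ^ 2 = 1 := by
      rw [← real_inner_self_eq_norm_sq, inner_fin_four, hp, hp, hp, hp]; linarith
    exact (pow_eq_one_iff_of_nonneg (norm_nonneg p) two_ne_zero).1 this
  · ext i k
    fin_cases i <;> fin_cases k <;> simp [rot, pow_two, hp] <;> simp [quatGram] <;> ring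

/-- The matrix of the cross product with `v`. -/
def crossMatrix (v : Fin 3 → ℝ) : Matrix (Fin 3) (Fin 3) ℝ :=
  !![0, -v 2, v 1; v 2, 0, -v 0; -v 1, v 0, 0]

theorem mul_crossMatrix_mul_transpose (Q : Matrix (Fin 3) (Fin 3) ℝ) (v : Fin 3 → ℝ) :
    Q * crossMatrix v * Qᵀ = crossMatrix (Q.adjugateᵀ *ᵥ v) := by
  ext i j
  fin_cases i <;> fin_cases j <;>
    simp [crossMatrix, adjugate_fin_three, Matrix.mul_apply, Matrix.mulVec, dotProduct,
      Fin.sum_univ_three] <;> ring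

theorem rot_eq (p : EuclideanSpace ℝ (Fin 4)) (v : Fin 3 → ℝ) (hv : ∀ i, v i = p i.succ) :
    rot p = (p 0 ^ 2 - v ⬝ᵥ v) • (1 : Matrix (Fin 3) (Fin 3) ℝ) + (2 * p 0) • crossMatrix v +
      (2 : ℝ) • vecMulVec v v := by
  ext i j
  fin_cases i <;> fin_cases j <;>
    simp [rot, crossMatrix, dotProduct, Fin.sum_univ_three, vecMulVec_apply, hv] <;> ring

/-- Conjugation by an orthogonal matrix `Q` acts on the quaternion `w + v` by
`w + v ↦ det Q • w + Q v`. -/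
theorem mul_rot_mul_transpose {Q : Matrix (Fin 3) (Fin 3) ℝ} (hQ : Q * Qᵀ = 1)
    {p q : EuclideanSpace ℝ (Fin 4)} (h0 : q 0 = Q.det * p 0)
    (hs : ∀ i : Fin 3, q i.succ = ∑ j : Fin 3, Q i j * p j.succ) :
    Q * rot p * Qᵀ = rot q := by
  have hdet : Q.det * Q.det = 1 := by
    have := congrArg Matrix.det hQ
    rwa [det_mul, det_transpose, det_one] at this
  have hQ' : Qᵀ * Q = 1 := mul_eq_one_comm.1 hQ
  let v : Fin 3 → ℝ := fun i => p i.succ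
  have hcross : Q * crossMatrix v * Qᵀ = Q.det • crossMatrix (Q *ᵥ v) := by
    rw [mul_crossMatrix_mul_transpose, adjugate_eq_det_smul_transpose hQ, transpose_smul,
      transpose_transpose, smul_mulVec]
    ext i j
    fin_cases i <;> fin_cases j <;> simp [crossMatrix]
  have hvv : Q * vecMulVec v v * Qᵀ = vecMulVec (Q *ᵥ v) (Q *ᵥ v) := by
    rw [mul_vecMulVec, vecMulVec_mul, vecMul_transpose]
  have hnorm : (Q *ᵥ v) ⬝ᵥ (Q *ᵥ v) = v ⬝ᵥ v := by
    rw [dotProduct_mulVec, vecMul_mulVec, hQ', vecMul_one]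
  rw [rot_eq p v fun _ => rfl, rot_eq q (Q *ᵥ v) fun i => (hs i).symm, hnorm]
  simp only [mul_add, add_mul, Matrix.mul_smul, Matrix.smul_mul, mul_one, hQ, hcross, hvv,
    smul_smul, h0]
  congr 3
  · linear_combination (-p 0 ^ 2) * hdet
  · ring

end Rotation

/-! ### The functional calculus of a rotation -/

section FunctionalCalculus

open Matrix Polynomial

/-- The Cayley–Hamilton theorem for a rotation, divided by `A`: the adjugate is the transpose. -/
theorem cayleyHamilton_SO_three {A : Matrix (Fin 3) (Fin 3) ℝ} (hA : A * Aᵀ = 1)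
    (hdet : A.det = 1) : A ^ 2 - A.trace • A + A.trace • 1 - Aᵀ = 0 := by
  have hadj : A.adjugate = Aᵀ := by rw [adjugate_eq_det_smul_transpose hA, hdet, one_smul]
  -- The coefficient of the linear term is the trace of the adjugate.
  have htr : A.adjugate.trace = A.trace := by rw [hadj, trace_transpose]
  rw [← hadj, pow_two]
  rw [adjugate_fin_three] at htr ⊢
  simp only [trace_fin_three, of_apply, cons_val] at htr
  ext i j
  fin_cases i <;> fin_cases j <;>
    simp [Matrix.mul_apply, Fin.sum_univ_three, trace_fin_three] <;> linarith

/-- The data of the eigenvalues `1, z, w`, with multiplicity, that the functional calculus of `A`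
needs: `A` is annihilated by `(X - 1) (X - z) (X - w)`, and the traces of `A` and `A²` are those of
`diag(1, z, w)`. Coincidences among `1, z, w` are allowed. -/
structure HasRotationEigenvalues (A : Matrix (Fin 3) (Fin 3) ℂ) (z w : ℂ) : Prop where
  aeval_eq_zero : aeval A ((X - C 1) * (X - C z) * (X - C w) : ℂ[X]) = 0
  trace_eq : A.trace = 1 + z + w
  trace_sq_eq : (A ^ 2).trace = 1 + z ^ 2 + w ^ 2

variable {A : Matrix (Fin 3) (Fin 3) ℂ} {z w : ℂ}

theorem HasRotationEigenvalues.spectrum_subset (h : HasRotationEigenvalues A z w) :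
    spectrum ℂ A ⊆ {1, z, w} := by
  intro x hx
  have h1 := spectrum.subset_polynomial_aeval A ((X - C 1) * (X - C z) * (X - C w) : ℂ[X])
    ⟨x, hx, rfl⟩
  rw [h.aeval_eq_zero, spectrum.zero_eq, Set.mem_singleton_iff] at h1
  simp only [eval_mul, eval_sub, eval_X, eval_C, mul_eq_zero, sub_eq_zero, or_assoc] at h1
  exact h1

theorem exists_quadratic_eq (g : ℂ → ℂ) (s : Finset ℂ) (hs : s.card ≤ 3) :
    ∃ a b c : ℂ, ∀ x ∈ s, g x = a + b * x + c * x ^ 2 := by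
  let P := Lagrange.interpolate s id g
  have hP : P.degree < 3 := (Lagrange.degree_interpolate_lt g (Set.injOn_id _)).trans_le
    (by exact_mod_cast hs)
  refine ⟨P.coeff 0, P.coeff 1, P.coeff 2, fun x hx => ?_⟩
  have h1 : P.eval x = g x :=
    Lagrange.eval_interpolate_at_node g (Set.injOn_id _) hx
  rw [← h1, eval_eq_sum_range' (n := 3) (by
    by_cases h0 : P = 0
    · simp [h0]
    · exact (natDegree_lt_iff_degree_lt h0).2 hP)]
  simp [Finset.sum_range_succ]

open scoped Matrix.Norms.L2Operator in
/-- On the at most three points of the spectrum, `g` agrees with a polynomial of degree at most `2`,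
so that the trace of `g(A)` is a combination of the traces of `1`, `A` and `A²`. -/
theorem HasRotationEigenvalues.trace_cfc [hA : IsStarNormal A]
    (h : HasRotationEigenvalues A z w) (g : ℂ → ℂ) :
    (cfc g A).trace = g 1 + g z + g w := by
  obtain ⟨a, b, c, habc⟩ := exists_quadratic_eq g {1, z, w} Finset.card_le_three
  have h1 : cfc g A = cfc (C a + C b * X + C c * X ^ 2 : ℂ[X]).eval A := by
    refine cfc_congr fun x hx => ?_
    have hx' := h.spectrum_subset hx
    rw [habc x (by simpa using hx')]
    simp
  rw [h1, cfc_polynomial _ _ hA, habc 1 (by simp), habc z (by simp), habc w (by simp)]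
  simp only [map_add, map_mul, aeval_C, aeval_X, map_pow, trace_add, Algebra.algebraMap_eq_smul_one,
    smul_mul, one_mul, trace_smul, trace_one, h.trace_eq, h.trace_sq_eq, Fintype.card_fin,
    smul_eq_mul]
  push_cast
  ring

theorem frobeniusNorm_sq {n : ℕ} (M : Matrix (Fin n) (Fin n) ℂ) :
    ((frobeniusNorm M ^ 2 : ℝ) : ℂ) = (star M * M).trace := by
  have h1 : frobeniusNorm M ^ 2 = ∑ i, ∑ j, ‖M i j‖ ^ 2 := by
    have : frobeniusNorm M = (∑ i, ∑ j, ‖M i j‖ ^ (2 : ℝ)) ^ (1 / 2 : ℝ) :=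
      frobenius_norm_def M
    rw [this, ← Real.sqrt_eq_rpow, Real.sq_sqrt (by positivity)]
    simp
  rw [h1, Finset.sum_comm, star_eq_conjTranspose, trace]
  push_cast
  refine Finset.sum_congr rfl fun j _ => ?_
  rw [diag_apply, mul_apply]
  refine Finset.sum_congr rfl fun i _ => ?_
  rw [conjTranspose_apply, Complex.star_def, ← Complex.normSq_eq_conj_mul_self,
    Complex.normSq_eq_norm_sq]
  push_cast
  rfl

open scoped Matrix.Norms.L2Operator in
theorem HasRotationEigenvalues.frobeniusNorm_cfc_sq [hA : IsStarNormal A]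
    (h : HasRotationEigenvalues A z w) (g : ℂ → ℂ) :
    frobeniusNorm (cfc g A) ^ 2 = ‖g 1‖ ^ 2 + ‖g z‖ ^ 2 + ‖g w‖ ^ 2 := by
  have hfin : (spectrum ℂ A).Finite := (Set.toFinite _).subset h.spectrum_subset
  have hc : ∀ k : ℂ → ℂ, ContinuousOn k (spectrum ℂ A) := fun k => hfin.continuousOn k
  have h1 : star (cfc g A) * cfc g A = cfc (fun x => star (g x) * g x) A := by
    rw [cfc_mul _ _ A (hc _) (hc _), cfc_star]
  have h2 := frobeniusNorm_sq (cfc g A)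
  rw [h1, h.trace_cfc] at h2
  simp only [Complex.star_def, ← Complex.normSq_eq_conj_mul_self, Complex.normSq_eq_norm_sq] at h2
  exact_mod_cast h2

/-- A rotation has the eigenvalues `1, z, z⁻¹` where `z` is determined by the trace, because
`A² - (tr A) A + (tr A) 1 = Aᵀ = A⁻¹`. -/
theorem hasRotationEigenvalues_of_SO_three {A : Matrix (Fin 3) (Fin 3) ℝ} (hA : A * Aᵀ = 1)
    (hdet : A.det = 1) {z w : ℂ} (hzw : z * w = 1) (htr : (A.trace : ℂ) = 1 + z + w) :
    HasRotationEigenvalues (A.map Complex.ofReal) z w := by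
  set B := A.map Complex.ofReal with hB
  have hBA : B = Complex.ofRealHom.mapMatrix A := rfl
  have htrB : B.trace = A.trace := by simp [hB, trace]
  have hBt : B * Bᵀ = 1 := by
    have := congrArg Complex.ofRealHom.mapMatrix hA
    rwa [map_mul, map_one] at this
  have hCH : B ^ 2 - (A.trace : ℂ) • B + (A.trace : ℂ) • 1 - Bᵀ = 0 := by
    have := congrArg Complex.ofRealHom.mapMatrix (cayleyHamilton_SO_three hA hdet)
    simp only [map_sub, map_add, map_pow, map_zero] at this
    rw [← this, hBA]
    ext i j
    simp [Matrix.one_apply, apply_ite Complex.ofReal]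
  have hsq : B ^ 2 = (A.trace : ℂ) • B - (A.trace : ℂ) • 1 + Bᵀ := by
    rw [← sub_eq_zero, ← hCH]; abel
  refine ⟨?_, htrB.trans htr, ?_⟩
  · have h3 : B ^ 3 - (A.trace : ℂ) • B ^ 2 + (A.trace : ℂ) • B - 1 = 0 := by
      have := congrArg (B * ·) hCH
      simp only [mul_sub, mul_add, mul_zero, Matrix.mul_smul, hBt, mul_one] at this
      rw [← this, pow_succ' B 2, pow_two]
    have hpoly : ((X - C 1) * (X - C z) * (X - C w) : ℂ[X]) =
        X ^ 3 - C (1 + z + w) * X ^ 2 + C (1 + z + w) * X - 1 := by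
      have hC : (C z * C w : ℂ[X]) = 1 := by rw [← C_mul, hzw, C_1]
      simp only [C_add, C_1]
      linear_combination (X - 1) * hC
    rw [hpoly, ← htr, ← h3]
    simp [Algebra.smul_def]
  · rw [hsq, trace_add, trace_sub, trace_smul, trace_smul, trace_transpose, trace_one, htrB, htr]
    simp only [smul_eq_mul, Fintype.card_fin]
    push_cast
    linear_combination 2 * hzw

end FunctionalCalculus

/-! ### Recovering small angles from the profile -/

section Profile

/-- The squared Frobenius norm of `f(C)` for a rotation `C` by the angle `θ`. -/
noncomputable def angleProfile (f : Circle → ℂ) (θ : ℝ) : ℝ :=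
  ‖f (Circle.exp θ)‖ ^ 2 + ‖f (Circle.exp (-θ))‖ ^ 2

/-- A curve through `0` with non-zero velocity strictly moves away from `0` for a short time. Strict
differentiability suffices; no second derivative of `‖h‖²` is needed. -/
theorem HasStrictDerivAt.exists_strictMonoOn_norm_sq {h : ℝ → ℂ} {a : ℂ}
    (hh : HasStrictDerivAt h a 0) (ha : a ≠ 0) (h0 : h 0 = 0) :
    ∃ δ > 0, StrictMonoOn (fun x => ‖h x‖ ^ 2) (Set.Ico 0 δ) := by
  have ha' : 0 < ‖a‖ := norm_pos_iff.2 ha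
  have h1 := hh.hasStrictFDerivAt.isLittleO.def (show 0 < ‖a‖ / 4 by positivity)
  obtain ⟨δ, hδ, hb⟩ := Metric.eventually_nhds_iff.1 h1
  have key : ∀ x y : ℝ, |x| < δ → |y| < δ → ‖h x - h y - (x - y) * a‖ ≤ ‖a‖ / 4 * |x - y| := by
    intro x y hx hy
    have := hb (y := (x, y)) (by simp [Prod.dist_eq, hx, hy])
    simpa using this
  refine ⟨δ, hδ, fun y hy x hx hyx => ?_⟩
  have hy0 := hy.1
  have ax : |x| < δ := by rw [abs_of_nonneg hx.1]; exact hx.2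
  have ay : |y| < δ := by rw [abs_of_nonneg hy.1]; exact hy.2
  have a0 : |(0 : ℝ)| < δ := by simpa using hδ
  -- `‖h x‖² - ‖h y‖² = ⟪h x - h y, h x + h y⟫`, and both vectors are close to multiples of `a`.
  have e1 := key x y ax ay
  have e2 : ‖h x + h y - (x + y) * a‖ ≤ ‖a‖ / 4 * (x + y) := by
    have e3 := key x 0 ax a0
    have e4 := key y 0 ay a0
    rw [h0, sub_zero, sub_zero, abs_of_nonneg hx.1] at e3
    rw [h0, sub_zero, sub_zero, abs_of_nonneg hy.1] at e4
    calc ‖h x + h y - (x + y) * a‖ = ‖(h x - (x - (0 : ℝ)) * a) + (h y - (y - (0 : ℝ)) * a)‖ := by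
          congr 1; push_cast; ring
      _ ≤ _ := norm_add_le_of_le e3 e4
      _ = _ := by ring
  rw [abs_of_pos (sub_pos.2 hyx)] at e1
  set u := h x - h y - (x - y) * a with hu
  set s := h x + h y - (x + y) * a with hs
  have hd : 0 < x - y := sub_pos.2 hyx
  have hsum : 0 < x + y := by linarith
  have id : ‖h x‖ ^ 2 - ‖h y‖ ^ 2 = inner ℝ (h x - h y) (h x + h y) := by
    rw [inner_add_right, inner_sub_left, inner_sub_left, real_inner_self_eq_norm_sq,
      real_inner_self_eq_norm_sq, real_inner_comm (h x) (h y)]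
    ring
  have hxy1 : h x - h y = (x - y) • a + u := by
    rw [hu, Complex.real_smul]; push_cast; ring
  have hxy2 : h x + h y = (x + y) • a + s := by
    rw [hs, Complex.real_smul]; push_cast; ring
  rw [hxy1, hxy2, inner_add_left, inner_add_right, inner_add_right, inner_smul_left,
    inner_smul_left, inner_smul_right, inner_smul_right, real_inner_self_eq_norm_sq] at id
  have b1 := neg_le_of_abs_le (abs_real_inner_le_norm a s)
  have b2 := neg_le_of_abs_le (abs_real_inner_le_norm u a)
  have b3 := neg_le_of_abs_le (abs_real_inner_le_norm u s)
  simp only [conj_trivial] at id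
  have c1 : -(‖a‖ * (‖a‖ / 4 * (x + y))) ≤ inner ℝ a s := by
    refine le_trans (neg_le_neg ?_) b1; gcongr
  have c2 : -(‖a‖ / 4 * (x - y) * ‖a‖) ≤ inner ℝ u a := by
    refine le_trans (neg_le_neg ?_) b2; gcongr
  have c3 : -(‖a‖ / 4 * (x - y) * (‖a‖ / 4 * (x + y))) ≤ inner ℝ u s := by
    refine le_trans (neg_le_neg ?_) b3; gcongr
  have d1 := mul_le_mul_of_nonneg_left c1 hd.le
  have d2 := mul_le_mul_of_nonneg_left c2 hsum.le
  have : 0 < (x - y) * (x + y) * ‖a‖ ^ 2 := by positivity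
  simp only
  nlinarith

/-- Near the angle `0`, the curve `t ↦ f (exp (i ε t))` agrees with a curve with non-zero velocity
at `0`; here `ε = ±1` gives the two terms of the profile. -/
theorem ConformalNearOne.hasStrictDerivAt {f : Circle → ℂ} (hf : ConformalNearOne f) (ε : ℝ)
    (hε : ε ≠ 0) :
    ∃ h : ℝ → ℂ, ∃ a ≠ 0, HasStrictDerivAt h a 0 ∧ ∀ᶠ t in 𝓝 0, f (Circle.exp (ε * t)) = h t := by
  obtain ⟨U, F, hU, h1, hF, hF', hfF⟩ := hf
  have hc : Continuous fun t : ℝ => Complex.exp ((ε * t : ℝ) * Complex.I) := by fun_prop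
  refine ⟨fun t => F (Complex.exp ((ε * t : ℝ) * Complex.I)), deriv F 1 * (ε * Complex.I),
    mul_ne_zero (hF' 1 h1) (by simpa using hε), ?_, ?_⟩
  · have d1 : HasStrictDerivAt F (deriv F 1) (Complex.exp ((ε * (0 : ℝ) : ℝ) * Complex.I)) := by
      have hA : AnalyticAt ℂ F 1 := hF.analyticAt (hU.mem_nhds h1)
      simpa using hA.hasStrictDerivAt
    have d2 : HasStrictDerivAt (fun t : ℝ => Complex.exp ((ε * t : ℝ) * Complex.I))
        (ε * Complex.I) 0 := by
      have l : HasStrictDerivAt (fun t : ℝ => (((ε * t : ℝ) : ℂ) * Complex.I))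
          (ε * Complex.I) 0 := by
        have l1 : HasStrictDerivAt (fun t : ℝ => (t : ℂ)) 1 0 :=
          Complex.ofRealCLM.hasStrictDerivAt
        have := (l1.const_mul (ε : ℂ)).mul_const Complex.I
        simpa using this
      simpa using l.cexp
    exact d1.comp (0 : ℝ) d2
  · have : ∀ᶠ t in 𝓝 (0 : ℝ), Complex.exp ((ε * t : ℝ) * Complex.I) ∈ U :=
      hc.continuousAt.eventually_mem (hU.mem_nhds (by simpa using h1))
    filter_upwards [this] with t ht
    rw [hfF _ (by rwa [Circle.coe_exp]), Circle.coe_exp]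

theorem Admissible.exists_strictMonoOn {f : Circle → ℂ} (hf : Admissible f) (ε : ℝ)
    (hε : ε ≠ 0) :
    ∃ δ > 0, StrictMonoOn (fun t : ℝ => ‖f (Circle.exp (ε * t))‖ ^ 2) (Set.Ico 0 δ) := by
  obtain ⟨h, a, ha, hd, hE⟩ := hf.conformal.hasStrictDerivAt ε hε
  have h0 : h 0 = 0 := by
    rw [← hE.self_of_nhds, hf.eq_zero_iff]; simp
  obtain ⟨δ, hδ, hm⟩ := hd.exists_strictMonoOn_norm_sq ha h0
  obtain ⟨δ', hδ', hb⟩ := Metric.eventually_nhds_iff.1 hE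
  refine ⟨min δ δ', lt_min hδ hδ', ?_⟩
  refine (hm.mono (Set.Ico_subset_Ico_right (min_le_left _ _))).congr fun t ht => ?_
  have : f (Circle.exp (ε * t)) = h t := hb (by
    rw [Real.dist_eq, sub_zero, abs_of_nonneg ht.1]; exact ht.2.trans_le (min_le_right _ _))
  simp [this]

theorem circle_exp_pi : Circle.exp Real.pi = -1 :=
  Circle.ext (by simp [Complex.exp_pi_mul_I])

/-- Away from the angle `0`, the profile is bounded below: on `[δ, π]` the function
`t ↦ f (exp (i t))` is continuous, by left continuity at `π`, and has no zero. -/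
theorem Admissible.exists_lt_angleProfile {f : Circle → ℂ} (hf : Admissible f) {δ : ℝ}
    (hδ : 0 < δ) : ∃ m > 0, ∀ θ ∈ Set.Icc δ Real.pi, m ≤ angleProfile f θ := by
  have hpos : ∀ t ∈ Set.Icc δ Real.pi, 0 < ‖f (Circle.exp t)‖ ^ 2 := by
    intro t ht
    have : f (Circle.exp t) ≠ 0 := by
      rw [Ne, hf.eq_zero_iff, ← Circle.arg_eq_zero,
        Circle.arg_exp (by linarith [ht.1, Real.pi_pos]) ht.2]
      linarith [ht.1]
    positivity
  have hcont : ContinuousOn (fun t : ℝ => f (Circle.exp t)) (Set.Icc δ Real.pi) := by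
    intro t ht
    rcases ht.2.lt_or_eq with hlt | rfl
    · refine ContinuousAt.continuousWithinAt ?_
      have hne : Circle.exp t ≠ -1 := by
        rw [← circle_exp_pi, Ne, ← Circle.arg_eq_arg,
          Circle.arg_exp (by linarith [ht.1, Real.pi_pos]) ht.2,
          Circle.arg_exp (by linarith [Real.pi_pos]) le_rfl]
        exact hlt.ne
      exact ContinuousAt.comp (f := fun t : ℝ => Circle.exp t)
        (hf.continuousOn.continuousAt (isOpen_compl_singleton.mem_nhds hne))
        Circle.exp.continuous.continuousAt
    · have : ContinuousWithinAt (fun t : ℝ => f (Circle.exp t)) (Set.Iio Real.pi) Real.pi := by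
        have := hf.tendsto_left
        rwa [← circle_exp_pi] at this
      exact (continuousWithinAt_Iio_iff_Iic.1 this).mono Set.Icc_subset_Iic_self
  obtain hemp | hne := (Set.Icc δ Real.pi).eq_empty_or_nonempty
  · exact ⟨1, one_pos, by simp [hemp]⟩
  obtain ⟨t, ht, hmin⟩ := isCompact_Icc.exists_isMinOn hne (hcont.norm.pow 2)
  refine ⟨_, hpos t ht, fun θ hθ => (hmin hθ).trans ?_⟩
  exact le_add_of_nonneg_right (sq_nonneg _)

/-- A sufficiently small angle is determined by the value of the profile. -/
theorem Admissible.exists_eq_of_angleProfile_eq {f : Circle → ℂ} (hf : Admissible f) :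
    ∃ r > 0, r < Real.pi ∧ ∀ θ ∈ Set.Icc 0 r, ∀ θ' ∈ Set.Icc 0 Real.pi,
      angleProfile f θ' = angleProfile f θ → θ' = θ := by
  obtain ⟨δ₁, hδ₁, hm₁⟩ := hf.exists_strictMonoOn 1 one_ne_zero
  obtain ⟨δ₂, hδ₂, hm₂⟩ := hf.exists_strictMonoOn (-1) (by norm_num)
  have hmono : StrictMonoOn (angleProfile f) (Set.Ico 0 (min δ₁ δ₂)) := by
    refine ((hm₁.mono (Set.Ico_subset_Ico_right (min_le_left _ _))).add
      (hm₂.mono (Set.Ico_subset_Ico_right (min_le_right _ _)))).congr fun t _ => ?_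
    simp [angleProfile]
  set δ := min δ₁ δ₂ with hδdef
  have hδ : 0 < δ := lt_min hδ₁ hδ₂
  obtain ⟨m, hm, hlow⟩ := hf.exists_lt_angleProfile hδ
  have hsmall : ∀ᶠ t in 𝓝 (0 : ℝ), angleProfile f t < m := by
    have hc : ∀ ε : ℝ, ε ≠ 0 → Tendsto (fun t : ℝ => ‖f (Circle.exp (ε * t))‖ ^ 2) (𝓝 0) (𝓝 0) := by
      intro ε hε
      obtain ⟨h, a, -, hd, hE⟩ := hf.conformal.hasStrictDerivAt ε hε
      have h0 : h 0 = 0 := by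
        rw [← hE.self_of_nhds, hf.eq_zero_iff]; simp
      have h1 : Tendsto (fun t => ‖h t‖ ^ 2) (𝓝 0) (𝓝 (‖h 0‖ ^ 2)) :=
        (hd.hasDerivAt.continuousAt.norm.pow 2).tendsto
      rw [h0, norm_zero, zero_pow two_ne_zero] at h1
      exact h1.congr' (hE.mono fun t ht => by simp [ht])
    have := (hc 1 one_ne_zero).add (hc (-1) (by norm_num))
    simp only [one_mul, neg_mul, add_zero] at this
    exact this.eventually_lt_const hm
  obtain ⟨ρ, hρ, hρm⟩ := Metric.eventually_nhds_iff.1 hsmall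
  have hδ2 : δ / 2 < δ := half_lt_self hδ
  refine ⟨min (min (δ / 2) (ρ / 2)) 1, by positivity,
    (min_le_right _ _).trans_lt (by linarith [Real.pi_gt_three]), fun θ hθ θ' hθ' heq => ?_⟩
  have hθδ : θ < δ := by
    have := hθ.2.trans ((min_le_left _ _).trans (min_le_left _ _)); linarith
  have hθρ : θ < ρ := by
    have := hθ.2.trans ((min_le_left _ _).trans (min_le_right _ _)); linarith
  have hlt : angleProfile f θ < m :=
    hρm (by rwa [Real.dist_eq, sub_zero, abs_of_nonneg hθ.1])
  have hθ'δ : θ' < δ := by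
    by_contra! hcon
    have := hlow θ' ⟨hcon, hθ'.2⟩
    linarith
  exact hmono.injOn ⟨hθ'.1, hθ'δ⟩ ⟨hθ.1, hθδ⟩ heq

end Profile

/-! ### The distance measure in terms of unit quaternions -/

section Distance

open Matrix

theorem SO.mul_transpose {n : ℕ} (A : SO n) :
    (A : Matrix (Fin n) (Fin n) ℝ) * (A : Matrix (Fin n) (Fin n) ℝ)ᵀ = 1 :=
  (mem_orthogonalGroup_iff _ _).1 (mem_specialOrthogonalGroup_iff.1 A.2).1

theorem SO.det_eq_one {n : ℕ} (A : SO n) : (A : Matrix (Fin n) (Fin n) ℝ).det = 1 :=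
  (mem_specialOrthogonalGroup_iff.1 A.2).2

theorem SO.coe_inv {n : ℕ} (A : SO n) :
    ((A⁻¹ : SO n) : Matrix (Fin n) (Fin n) ℝ) = (A : Matrix (Fin n) (Fin n) ℝ)ᵀ := by
  change star (A : Matrix (Fin n) (Fin n) ℝ) = _
  rw [star_eq_conjTranspose, conjTranspose_eq_transpose_of_trivial]

theorem OrthoGroup.mul_transpose {n : ℕ} (A : OrthoGroup n) :
    (A : Matrix (Fin n) (Fin n) ℝ) * (A : Matrix (Fin n) (Fin n) ℝ)ᵀ = 1 :=
  (mem_orthogonalGroup_iff _ _).1 A.2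

theorem OrthoGroup.coe_inv {n : ℕ} (A : OrthoGroup n) :
    ((A⁻¹ : OrthoGroup n) : Matrix (Fin n) (Fin n) ℝ) = (A : Matrix (Fin n) (Fin n) ℝ)ᵀ := by
  change star (A : Matrix (Fin n) (Fin n) ℝ) = _
  rw [star_eq_conjTranspose, conjTranspose_eq_transpose_of_trivial]

instance isStarNormal_map_ofReal {n : ℕ} (A : SO n) :
    IsStarNormal ((A : Matrix (Fin n) (Fin n) ℝ).map Complex.ofReal) := by
  have h1 : star ((A : Matrix (Fin n) (Fin n) ℝ).map Complex.ofReal) =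
      Complex.ofRealHom.mapMatrix (A : Matrix (Fin n) (Fin n) ℝ)ᵀ := by
    ext i j; simp
  have h2 : (A : Matrix (Fin n) (Fin n) ℝ).map Complex.ofReal =
      Complex.ofRealHom.mapMatrix (A : Matrix (Fin n) (Fin n) ℝ) := rfl
  refine ⟨?_⟩
  rw [Commute, SemiconjBy, h1, h2, ← map_mul, ← map_mul, A.mul_transpose,
    mul_eq_one_comm.1 A.mul_transpose]

/-- The quaternion `1`. -/
noncomputable def quatOne : EuclideanSpace ℝ (Fin 4) := EuclideanSpace.single 0 1

theorem norm_quatOne : ‖quatOne‖ = 1 := by simp [quatOne]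

theorem inner_quatOne (p : EuclideanSpace ℝ (Fin 4)) : inner ℝ quatOne p = p 0 := by
  simp [quatOne, EuclideanSpace.inner_single_left]

theorem rot_quatOne : rot quatOne = 1 := by
  ext i j
  fin_cases i <;> fin_cases j <;> simp [rot, quatOne]

theorem SO.exists_rot_eq (A : SO 3) :
    ∃ p : EuclideanSpace ℝ (Fin 4), ‖p‖ = 1 ∧ rot p = (A : Matrix (Fin 3) (Fin 3) ℝ) :=
  _root_.exists_rot_eq A.mul_transpose A.det_eq_one

theorem rot_mem {p : EuclideanSpace ℝ (Fin 4)} (hp : ‖p‖ = 1) :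
    rot p ∈ specialOrthogonalGroup (Fin 3) ℝ := by
  have h1 : p 0 * p 0 + p 1 * p 1 + p 2 * p 2 + p 3 * p 3 = 1 := by
    rw [← inner_fin_four, real_inner_self_eq_norm_sq, hp, one_pow]
  refine mem_specialOrthogonalGroup_iff.2 ⟨(mem_orthogonalGroup_iff _ _).2 ?_, ?_⟩
  · have : rot p * (rot p)ᵀ =
        (p 0 * p 0 + p 1 * p 1 + p 2 * p 2 + p 3 * p 3) ^ 2 • (1 : Matrix (Fin 3) (Fin 3) ℝ) := by
      ext i j
      fin_cases i <;> fin_cases j <;>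
        simp [rot, Matrix.mul_apply, Fin.sum_univ_three] <;> ring
    rw [this, h1, one_pow, one_smul]
  · have : (rot p).det = (p 0 * p 0 + p 1 * p 1 + p 2 * p 2 + p 3 * p 3) ^ 3 := by
      rw [det_fin_three]; simp [rot]; ring
    rw [this, h1, one_pow]

theorem sq_inner_le_one {E : Type*} [NormedAddCommGroup E] [InnerProductSpace ℝ E] {p q : E}
    (hp : ‖p‖ = 1) (hq : ‖q‖ = 1) : inner ℝ p q ^ 2 ≤ 1 := by
  have := abs_real_inner_le_norm p q
  rw [hp, hq, mul_one] at this
  exact (sq_le_one_iff_abs_le_one _).2 this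

theorem extendCircle_coe (f : Circle → ℂ) (z : Circle) : extendCircle f z = f z :=
  dif_pos z.2

/-- The norm of `f(C)` depends only on the rotation angle of `C`, which is determined by the
trace. -/
theorem frobeniusNorm_applySO {f : Circle → ℂ} (hf : Admissible f) (C : SO 3) :
    frobeniusNorm (applySO f C) = √(angleProfile f
      (Real.arccos (((C : Matrix (Fin 3) (Fin 3) ℝ).trace - 1) / 2))) := by
  set t := (C : Matrix (Fin 3) (Fin 3) ℝ).trace with ht
  obtain ⟨p, hp, hpC⟩ := C.exists_rot_eq
  have htp : t = 4 * inner ℝ quatOne p ^ 2 - 1 := by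
    rw [← trace_rot_transpose_mul_rot norm_quatOne hp, rot_quatOne, transpose_one, one_mul, hpC]
  have hle := sq_inner_le_one norm_quatOne hp
  have hnn := sq_nonneg (inner ℝ quatOne p)
  have hcos : Real.cos (Real.arccos ((t - 1) / 2)) = (t - 1) / 2 :=
    Real.cos_arccos (by linarith) (by linarith)
  set θ := Real.arccos ((t - 1) / 2)
  have hzw : (Circle.exp θ : ℂ) * (Circle.exp (-θ) : ℂ) = 1 := by
    rw [← Circle.coe_mul, ← Circle.exp_add]; simp
  have htr : (t : ℂ) = 1 + Circle.exp θ + Circle.exp (-θ) := by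
    have h2 : (t : ℂ) = 1 + 2 * Complex.cos θ := by
      rw [← Complex.ofReal_cos, hcos]; push_cast; ring
    rw [h2, Complex.two_cos, Circle.coe_exp, Circle.coe_exp]; push_cast; ring
  have hE := hasRotationEigenvalues_of_SO_three C.mul_transpose C.det_eq_one hzw htr
  have hsq := hE.frobeniusNorm_cfc_sq (extendCircle f)
  have h1 : extendCircle f 1 = 0 := by
    rw [← Circle.coe_one, extendCircle_coe, hf.eq_zero_iff]
  rw [h1, extendCircle_coe, extendCircle_coe, norm_zero, zero_pow two_ne_zero, zero_add] at hsq
  rw [angleProfile, ← hsq]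
  refine (Real.sqrt_sq ?_).symm
  exact @norm_nonneg _
    Matrix.frobeniusNormedAddCommGroup.toSeminormedAddCommGroup.toSeminormedAddGroup _

theorem genDist_eq_iff {N : Matrix (Fin 3) (Fin 3) ℂ → ℝ} (hN : IsFrobeniusMultiple N)
    {f : Circle → ℂ} (hf : Admissible f) (A B A' B' : SO 3) :
    genDist N f A B = genDist N f A' B' ↔
      angleProfile f (Real.arccos (((A : Matrix (Fin 3) (Fin 3) ℝ)ᵀ *
        (B : Matrix (Fin 3) (Fin 3) ℝ)).trace / 2 - 1 / 2)) =
      angleProfile f (Real.arccos (((A' : Matrix (Fin 3) (Fin 3) ℝ)ᵀ *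
        (B' : Matrix (Fin 3) (Fin 3) ℝ)).trace / 2 - 1 / 2)) := by
  obtain ⟨c, hc, hN⟩ := hN
  have hnn : ∀ θ, 0 ≤ angleProfile f θ := fun θ => by unfold angleProfile; positivity
  rw [genDist, genDist, hN, hN, mul_right_inj' hc.ne', frobeniusNorm_applySO hf,
    frobeniusNorm_applySO hf, Real.sqrt_inj (hnn _) (hnn _), Submonoid.coe_mul, Submonoid.coe_mul,
    SO.coe_inv, SO.coe_inv, sub_div, sub_div]

end Distance

/-! ### Distance-preserving maps -/

section Preservers

open Matrix

/-- An isometry fixing the quaternion `1` is an orthogonal map of the imaginary quaternions. -/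
theorem exists_orthogonal_of_fix_quatOne
    {T : EuclideanSpace ℝ (Fin 4) ≃ₗᵢ[ℝ] EuclideanSpace ℝ (Fin 4)} (hT : T quatOne = quatOne) :
    ∃ Q : Matrix (Fin 3) (Fin 3) ℝ, Q * Qᵀ = 1 ∧ ∀ p, T p 0 = p 0 ∧
      ∀ i : Fin 3, T p i.succ = ∑ j : Fin 3, Q i j * p j.succ := by
  have h0 : ∀ p, T p 0 = p 0 := fun p => by
    rw [← inner_quatOne, ← inner_quatOne, ← T.inner_map_map quatOne p, hT]
  let e : Fin 4 → EuclideanSpace ℝ (Fin 4) := fun j => EuclideanSpace.single j 1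
  have he : ∀ j, T (e (Fin.succ j)) 0 = 0 := fun j => by
    rw [h0]; simp [e]
  refine ⟨of fun i j => T (e j.succ) i.succ, ?_, fun p => ⟨h0 p, fun i => ?_⟩⟩
  · rw [mul_eq_one_comm]
    ext i j
    have h1 : inner ℝ (T (e i.succ)) (T (e j.succ)) = if i = j then 1 else 0 := by
      rw [T.inner_map_map]
      simp [e, EuclideanSpace.inner_single_left, Fin.succ_inj]
    rw [PiLp.inner_apply, Fin.sum_univ_succ, he, inner_zero_left, zero_add] at h1
    rw [Matrix.mul_apply, Matrix.one_apply, ← h1]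
    refine Finset.sum_congr rfl fun k _ => ?_
    simp [mul_comm]
  · have hp : p = p 0 • quatOne + ∑ j : Fin 3, p j.succ • e j.succ := by
      ext k
      refine Fin.cases ?_ (fun k => ?_) k <;> simp [quatOne, e, Pi.single_apply, Fin.succ_inj]
    conv_lhs => rw [hp]
    rw [map_add, map_sum, map_smul, hT]
    simp [quatOne, mul_comm]

/-- If `Φ` is the isometry `T` up to signs and fixes `e` up to sign, then `T` or `-T` fixes `e`. -/
theorem exists_linearIsometryEquiv_fix {E : Type*} [NormedAddCommGroup E] [InnerProductSpace ℝ E]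
    {Φ : E → E} {T : E ≃ₗᵢ[ℝ] E} (hT : ∀ p, ‖p‖ = 1 → Φ p = T p ∨ Φ p = -T p) {e : E}
    (he : ‖e‖ = 1) (hΦe : Φ e = e ∨ Φ e = -e) :
    ∃ T' : E ≃ₗᵢ[ℝ] E, T' e = e ∧ ∀ p, ‖p‖ = 1 → Φ p = T' p ∨ Φ p = -T' p := by
  have : T e = e ∨ T e = -e := by
    rcases hT e he with h | h <;> rcases hΦe with h' | h' <;> rw [h'] at h
    · exact .inl h.symm
    · exact .inr h.symm
    · exact .inr (neg_eq_iff_eq_neg.1 h.symm)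
    · exact .inl (neg_injective h).symm
  rcases this with h | h
  · exact ⟨T, h, hT⟩
  · refine ⟨T.trans (LinearIsometryEquiv.neg ℝ), by simp [h], fun p hp => ?_⟩
    simpa [or_comm] using hT p hp

/-- Up to a left multiplication, a map preserving the distance measure is given by a linear isometry
of the quaternions fixing `1`. Only pairs of rotations at small angle are used: their angle is
determined by the distance measure, hence preserved. -/
theorem exists_linearIsometryEquiv_of_genDist {N : Matrix (Fin 3) (Fin 3) ℂ → ℝ}
    (hN : IsFrobeniusMultiple N) {f : Circle → ℂ} (hf : Admissible f) {φ : SO 3 → SO 3}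
    (h : ∀ A B : SO 3, genDist N f (φ A) (φ B) = genDist N f A B) :
    ∃ T : EuclideanSpace ℝ (Fin 4) ≃ₗᵢ[ℝ] EuclideanSpace ℝ (Fin 4), T quatOne = quatOne ∧
      ∀ (A : SO 3) p, ‖p‖ = 1 → rot p = (A : Matrix (Fin 3) (Fin 3) ℝ) →
        (((φ 1)⁻¹ * φ A : SO 3) : Matrix (Fin 3) (Fin 3) ℝ) = rot (T p) := by
  have hex : ∀ p : EuclideanSpace ℝ (Fin 4), ∃ q : EuclideanSpace ℝ (Fin 4), ‖p‖ = 1 →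
      ‖q‖ = 1 ∧ ∀ A : SO 3, rot p = (A : Matrix (Fin 3) (Fin 3) ℝ) →
        rot q = (((φ 1)⁻¹ * φ A : SO 3) : Matrix (Fin 3) (Fin 3) ℝ) := by
    intro p
    by_cases hp : ‖p‖ = 1
    · obtain ⟨q, hq, hqA⟩ := SO.exists_rot_eq ((φ 1)⁻¹ * φ ⟨rot p, rot_mem hp⟩)
      refine ⟨q, fun _ => ⟨hq, fun A hA => ?_⟩⟩
      obtain rfl : A = ⟨rot p, rot_mem hp⟩ := Subtype.ext hA.symm
      exact hqA
    · exact ⟨0, fun h => absurd h hp⟩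
  choose Φ hΦ using hex
  obtain ⟨r, hr0, hrπ, hr⟩ := hf.exists_eq_of_angleProfile_eq
  have hcosr : Real.cos r < 1 := by
    rw [← Real.cos_zero]; exact Real.cos_lt_cos_of_nonneg_of_le_pi le_rfl hrπ.le hr0
  -- The threshold is `cos (r / 2)`: the rotation angle is twice the angle of the quaternions.
  have hpres : PreservesAbsInner √((1 + Real.cos r) / 2) Φ := by
    refine ⟨fun p hp => (hΦ p hp).1, fun p q hp hq hpq => ?_⟩
    have hs1 := sq_inner_le_one hp hq
    have hs2 := sq_inner_le_one (hΦ p hp).1 (hΦ q hq).1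
    have hs0 := sq_nonneg (inner ℝ p q)
    have hs0' := sq_nonneg (inner ℝ (Φ p) (Φ q))
    have hd := h ⟨rot p, rot_mem hp⟩ ⟨rot q, rot_mem hq⟩
    rw [show genDist N f (φ ⟨rot p, rot_mem hp⟩) (φ ⟨rot q, rot_mem hq⟩) =
      genDist N f ((φ 1)⁻¹ * φ ⟨rot p, rot_mem hp⟩) ((φ 1)⁻¹ * φ ⟨rot q, rot_mem hq⟩) by
        unfold genDist; congr 2; group,
      genDist_eq_iff hN hf, ← (hΦ p hp).2 ⟨rot p, rot_mem hp⟩ rfl,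
      ← (hΦ q hq).2 ⟨rot q, rot_mem hq⟩ rfl,
      trace_rot_transpose_mul_rot (hΦ p hp).1 (hΦ q hq).1,
      trace_rot_transpose_mul_rot hp hq] at hd
    have hle : Real.arccos ((4 * inner ℝ p q ^ 2 - 1) / 2 - 1 / 2) ≤ r := by
      rw [← Real.arccos_cos hr0.le hrπ.le]
      refine Real.arccos_le_arccos ?_
      rw [← Real.sqrt_sq_eq_abs, Real.sqrt_le_sqrt_iff hs0] at hpq
      linarith
    have harc := Real.arccos_injOn ⟨by linarith, by linarith⟩ ⟨by linarith, by linarith⟩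
      (hr _ ⟨Real.arccos_nonneg _, hle⟩ _ ⟨Real.arccos_nonneg _, Real.arccos_le_pi _⟩ hd)
    rw [← sq_eq_sq_iff_abs_eq_abs]
    linarith
  have hκ : √((1 + Real.cos r) / 2) < 1 := by
    rw [Real.sqrt_lt' one_pos]; linarith
  obtain ⟨T, hT⟩ := hpres.exists_linearIsometryEquiv hκ (by
    rw [← Module.finrank_eq_rank, finrank_euclideanSpace_fin]; norm_num)
  have hone : Φ quatOne = quatOne ∨ Φ quatOne = -quatOne := by
    have h1 := (hΦ quatOne norm_quatOne).2 1 (by rw [rot_quatOne]; rfl)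
    have h2 := trace_rot_transpose_mul_rot norm_quatOne (hΦ quatOne norm_quatOne).1
    rw [h1, inv_mul_cancel, rot_quatOne] at h2
    simp only [transpose_one, one_mul, Submonoid.coe_one, trace_one, Fintype.card_fin] at h2
    push_cast at h2
    have h3 : inner ℝ quatOne (Φ quatOne) ^ 2 = 1 := by linarith
    rcases mul_self_eq_one_iff.1 ((pow_two _).symm.trans h3) with h4 | h4
    · exact .inl ((inner_eq_one_iff_of_norm_eq_one (𝕜 := ℝ) norm_quatOne
        (hΦ quatOne norm_quatOne).1).1 h4).symm
    · refine .inr (neg_eq_iff_eq_neg.1 ((inner_eq_one_iff_of_norm_eq_one (𝕜 := ℝ) norm_quatOne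
        (by rw [norm_neg]; exact (hΦ quatOne norm_quatOne).1)).1 ?_).symm)
      rw [inner_neg_right, h4, neg_neg]
  obtain ⟨T', hT'1, hT'⟩ := exists_linearIsometryEquiv_fix hT norm_quatOne hone
  refine ⟨T', hT'1, fun A p hp hA => ?_⟩
  rw [← (hΦ p hp).2 A hA]
  rcases hT' p hp with h' | h' <;> simp [h', rot_neg]

end Preservers

theorem theorem2 (N : Matrix (Fin 3) (Fin 3) ℂ → ℝ) (hN : IsFrobeniusMultiple N)
    (f : Circle → ℂ) (hf : Admissible f) (φ : SO 3 → SO 3) :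
    (∀ A B : SO 3, genDist N f (φ A) (φ B) = genDist N f A B) ↔
      ∃ Q : OrthoGroup 3,
        (∀ A : SO 3, (φ A : Matrix (Fin 3) (Fin 3) ℝ) =
          (φ 1 : Matrix (Fin 3) (Fin 3) ℝ) * (Q : Matrix (Fin 3) (Fin 3) ℝ) *
            (A : Matrix (Fin 3) (Fin 3) ℝ) *
            ((Q⁻¹ : OrthoGroup 3) : Matrix (Fin 3) (Fin 3) ℝ)) ∨
        (∀ A : SO 3, (φ A : Matrix (Fin 3) (Fin 3) ℝ) =
          (φ 1 : Matrix (Fin 3) (Fin 3) ℝ) * (Q : Matrix (Fin 3) (Fin 3) ℝ) *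
            ((A⁻¹ : SO 3) : Matrix (Fin 3) (Fin 3) ℝ) *
            ((Q⁻¹ : OrthoGroup 3) : Matrix (Fin 3) (Fin 3) ℝ)) := by
  constructor
  · intro h
    obtain ⟨T, hT1, hT⟩ := exists_linearIsometryEquiv_of_genDist hN hf h
    obtain ⟨Q, hQ, hTQ⟩ := exists_orthogonal_of_fix_quatOne hT1
    have hQmem : Q ∈ Matrix.orthogonalGroup (Fin 3) ℝ := by
      rwa [Matrix.mem_orthogonalGroup_iff]
    have hφ : ∀ (A : SO 3) p, ‖p‖ = 1 → rot p = (A : Matrix (Fin 3) (Fin 3) ℝ) →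
        (φ A : Matrix (Fin 3) (Fin 3) ℝ) = (φ 1 : Matrix (Fin 3) (Fin 3) ℝ) * rot (T p) := by
      intro A p hp hA
      rw [← hT A p hp hA, ← Submonoid.coe_mul, mul_inv_cancel_left]
    have hdet : Q.det = 1 ∨ Q.det = -1 := by
      have := congrArg Matrix.det hQ
      rw [Matrix.det_mul, Matrix.det_transpose, Matrix.det_one] at this
      exact mul_self_eq_one_iff.1 this
    refine ⟨⟨Q, hQmem⟩, hdet.imp (fun hd A => ?_) (fun hd A => ?_)⟩ <;>
      obtain ⟨p, hp, hA⟩ := A.exists_rot_eq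
    · rw [hφ A p hp hA, OrthoGroup.coe_inv, ← hA,
        ← mul_rot_mul_transpose hQ (by rw [hd, one_mul, (hTQ p).1]) (hTQ p).2]
      simp only [mul_assoc]
    · -- The transpose of a rotation belongs to the conjugate quaternion.
      let p' : EuclideanSpace ℝ (Fin 4) := WithLp.toLp 2 ![-p 0, p 1, p 2, p 3]
      have hp' : rot p' = (rot p).transpose := by
        ext i j
        fin_cases i <;> fin_cases j <;> simp [rot, p'] <;> ring
      have hs : ∀ j : Fin 3, p' j.succ = p j.succ := by
        intro j; fin_cases j <;> rfl
      rw [hφ A p hp hA, OrthoGroup.coe_inv, SO.coe_inv, ← hA, ← hp',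
        ← mul_rot_mul_transpose hQ (p := p') (by rw [hd, (hTQ p).1]; simp [p'])
          (fun i => by simp only [hs, (hTQ p).2])]
      simp only [mul_assoc]
  · rintro ⟨Q, h⟩ A B
    have hQ : (Q : Matrix (Fin 3) (Fin 3) ℝ).transpose * (Q : Matrix (Fin 3) (Fin 3) ℝ) = 1 :=
      mul_eq_one_comm.1 Q.mul_transpose
    have h1 : (φ 1 : Matrix (Fin 3) (Fin 3) ℝ).transpose * (φ 1 : Matrix (Fin 3) (Fin 3) ℝ) = 1 :=
      mul_eq_one_comm.1 (φ 1).mul_transpose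
    -- Left multiplication by `φ 1` and conjugation by `Q` drop out of the trace.
    have key : ∀ X Y : Matrix (Fin 3) (Fin 3) ℝ,
        (((φ 1 : Matrix (Fin 3) (Fin 3) ℝ) * Q * X *
            (Q : Matrix (Fin 3) (Fin 3) ℝ).transpose).transpose *
          ((φ 1 : Matrix (Fin 3) (Fin 3) ℝ) * Q * Y *
            (Q : Matrix (Fin 3) (Fin 3) ℝ).transpose)).trace = (X.transpose * Y).trace := by
      intro X Y
      generalize (Q : Matrix (Fin 3) (Fin 3) ℝ) = R at hQ ⊢
      generalize (φ 1 : Matrix (Fin 3) (Fin 3) ℝ) = S at h1 ⊢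
      calc _ = (R * X.transpose * (R.transpose * (S.transpose * S) * R) * Y *
              R.transpose).trace := by
            simp only [Matrix.transpose_mul, Matrix.transpose_transpose, mul_assoc]
        _ = _ := by
          rw [h1, mul_one, hQ, mul_one, Matrix.trace_mul_comm, ← mul_assoc, ← mul_assoc, hQ,
            one_mul]
    rw [genDist_eq_iff hN hf]
    rcases h with h | h
    · rw [h A, h B, OrthoGroup.coe_inv, key]
    · rw [h A, h B, OrthoGroup.coe_inv, key, SO.coe_inv, SO.coe_inv, Matrix.transpose_transpose,
        Matrix.trace_mul_comm, ← Matrix.trace_transpose, Matrix.transpose_mul,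
        Matrix.transpose_transpose, Matrix.trace_mul_comm]
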